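/- A *singular triangulation* $\mathcal T$ consists of finitely many Euclidean 4-simplices (*pentachora*) together with affine isomorphisms pairing their facets: each facet is the domain of exactly one pairing, and the inverse of a pairing is a pairing. Let $|\mathcal T|$ be the quotient of the disjoint union of the pentachora by the face pairings; the vertices of $\mathcal T$ are the classes of vertices of pentachora under the face pairings. A singular triangulation of a PL 4-manifold $M$ is such a $\mathcal T$ with a PL homeomorphism $|\mathcal T|\to M$. A *tricoloring* of $\mathcal T$ is a partition $\{P_0,P_1,P_2\}$ of its set of vertices such that every pentachoron has two vertices in each of two of the sets and one vertex in the remaining set (vertices being counted in the pentachoron, before identification). The *monochromatic graph* $\Gamma_k\subset|\mathcal T|$ is the union of the images of all simplices whose vertices all lie in $P_k$. **Statement.** Let $M$ be a closed, connected PL 4-manifold with a singular triangulation $h:|\mathcal T|\to M$ having $n$ pentachora. Then there are a singular triangulation $\mathcal T'$ with $60n$ pentachora and a homeomorphism $\varphi:|\mathcal T'|\to|\mathcal T|$ such that 1. $\mathcal T'$ is a subdivision of $\mathcal T$ via $\varphi$: each pentachoron of $\mathcal T'$ is mapped by $\varphi$ affinely onto a (nondegenerate) 4-simplex in a pentachoron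 of $\mathcal T$, and each pentachoron of $\mathcal T$ is subdivided into exactly $60$ pentachora of $\mathcal T'$; 2. $h\circ\varphi:|\mathcal T'|\to M$ is a PL homeomorphism, so $\mathcal T'$ is a singular triangulation of $M$; 3. if the pentachora of $\mathcal T$ can be oriented so that all face pairings are orientation reversing, then the same holds for $\mathcal T'$; and if no facet of $\mathcal T$ is paired with itself, then the same holds for $\mathcal T'$; 4. $\mathcal T'$ admits a tricoloring for which two of the monochromatic graphs are connected and the third is a non-empty set of isolated vertices (it contains no edge and is discrete). -/

import Mathlib

open Topology

noncomputable section

/-! ### Piecewise linear manifolds -/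

/-- `f` is piecewise linear on `u`: it is continuous on `u` and, near each point of `u`, its values
are selected from finitely many affine maps. -/
def PLOn {E F : Type*} [NormedAddCommGroup E] [NormedSpace ℝ E]
    [NormedAddCommGroup F] [NormedSpace ℝ F] (f : E → F) (u : Set E) : Prop :=
  ContinuousOn f u ∧
    ∀ x ∈ u, ∃ A : Set (E →ᵃ[ℝ] F), A.Finite ∧ ∀ᶠ y in 𝓝[u] x, ∃ a ∈ A, f y = a y

/-- Piecewise linear maps between open subsets of `ℝⁿ` form a pregroupoid. -/
def plPregroupoid (n : ℕ) : Pregroupoid (EuclideanSpace ℝ (Fin n)) where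
  property := PLOn
  comp := by
    rintro f g u v ⟨hfc, hf⟩ ⟨hgc, hg⟩ hu hv huv
    refine ⟨hgc.comp (hfc.mono Set.inter_subset_left) fun x hx => hx.2, ?_⟩
    rintro x ⟨hxu, hxv⟩
    obtain ⟨A, hA, hA'⟩ := hf x hxu
    obtain ⟨B, hB, hB'⟩ := hg (f x) hxv
    refine ⟨Set.image2 (fun b a => b.comp a) B A, hB.image2 _ hA, ?_⟩
    have ht : Filter.Tendsto f (𝓝[u ∩ f ⁻¹' v] x) (𝓝[v] (f x)) :=
      ((hfc x hxu).mono Set.inter_subset_left).tendsto_nhdsWithin fun y hy => hy.2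
    filter_upwards [ht.eventually hB', nhdsWithin_mono x Set.inter_subset_left hA']
      with y ⟨b, hb, hby⟩ ⟨a, ha, hay⟩
    exact ⟨b.comp a, ⟨b, hb, a, ha, rfl⟩, by simp [hby, ← hay]⟩
  id_mem := ⟨continuousOn_id, fun x _ =>
    ⟨{AffineMap.id ℝ _}, Set.finite_singleton _, Filter.Eventually.of_forall fun y => by simp⟩⟩
  locality := by
    intro f u hu h
    constructor
    · intro x hx
      obtain ⟨v, hv, hxv, hfv⟩ := h x hx
      have := hfv.1 x ⟨hx, hxv⟩
      exact (continuousWithinAt_inter (hv.mem_nhds hxv)).1 this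
    · intro x hx
      obtain ⟨v, hv, hxv, hfv⟩ := h x hx
      obtain ⟨A, hA, hA'⟩ := hfv.2 x ⟨hx, hxv⟩
      refine ⟨A, hA, ?_⟩
      rwa [nhdsWithin_inter_of_mem' (mem_nhdsWithin_of_mem_nhds (hv.mem_nhds hxv))] at hA'
  congr := by
    rintro f g u hu hfg ⟨hfc, hf⟩
    refine ⟨hfc.congr hfg, fun x hx => ?_⟩
    obtain ⟨A, hA, hA'⟩ := hf x hx
    refine ⟨A, hA, ?_⟩
    filter_upwards [hA', self_mem_nhdsWithin] with y ⟨a, ha, hay⟩ hyu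
    exact ⟨a, ha, (hfg y hyu).trans hay⟩

/-- The groupoid of piecewise linear homeomorphisms between open subsets of `ℝⁿ`. A PL
`n`-manifold is a charted space over `ℝⁿ` whose coordinate changes lie in it. -/
def plGroupoid (n : ℕ) : StructureGroupoid (EuclideanSpace ℝ (Fin n)) :=
  (plPregroupoid n).groupoid

/-! ### Singular triangulations of 4-manifolds -/

/-- Finitely many standard 4-simplices (pentachora) with vertices labelled by `Fin 5`, and affine
face pairings. The facet of `s` opposite to its vertex `i` is identified with the facet of `adj s i`
opposite to the vertex `glue s i i`, by the affine isomorphism which sends the vertex `k ≠ i`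
to the vertex `glue s i k`. -/
structure SingularTriangulation where
  Pentachoron : Type
  [finite : Finite Pentachoron]
  adj : Pentachoron → Fin 5 → Pentachoron
  glue : Pentachoron → Fin 5 → Equiv.Perm (Fin 5)
  adj_adj : ∀ s i, adj (adj s i) (glue s i i) = s
  glue_glue : ∀ s i, glue (adj s i) (glue s i i) = (glue s i)⁻¹

namespace SingularTriangulation

instance instFinitePentachoron (T : SingularTriangulation) : Finite T.Pentachoron := T.finite

/-- The disjoint union of the pentachora. -/
abbrev Pieces (T : SingularTriangulation) : Type :=
  Σ _ : T.Pentachoron, stdSimplex ℝ (Fin 5)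

/-- Points of facets that are matched by a face pairing. -/
inductive PointRel (T : SingularTriangulation) : T.Pieces → T.Pieces → Prop
  | glue (s : T.Pentachoron) (i : Fin 5) (x : stdSimplex ℝ (Fin 5)) (hx : x i = 0) :
      PointRel T ⟨s, x⟩ ⟨T.adj s i, stdSimplex.map (T.glue s i) x⟩

/-- The quotient space `|T|`, with the quotient topology. -/
abbrev Space (T : SingularTriangulation) : Type := Quot T.PointRel

/-- The quotient map, on the pentachoron `s`. -/
def proj (T : SingularTriangulation) (s : T.Pentachoron) (x : stdSimplex ℝ (Fin 5)) : T.Space :=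
  Quot.mk T.PointRel ⟨s, x⟩

/-- Vertices of pentachora that are matched by a face pairing. -/
inductive VertexRel (T : SingularTriangulation) :
    T.Pentachoron × Fin 5 → T.Pentachoron × Fin 5 → Prop
  | glue (s : T.Pentachoron) (i k : Fin 5) (hk : k ≠ i) :
      VertexRel T (s, k) (T.adj s i, T.glue s i k)

/-- The vertices of `T`: classes of vertices of pentachora under the face pairings. -/
abbrev Vertex (T : SingularTriangulation) : Type := Quot T.VertexRel

/-- The class of the vertex `k` of the pentachoron `s`. -/
def vertex (T : SingularTriangulation) (s : T.Pentachoron) (k : Fin 5) : T.Vertex :=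
  Quot.mk T.VertexRel (s, k)

/-- The pentachora can be oriented (`ε s = 1` being the orientation given by the order of the
labels of `s`) so that all face pairings reverse the induced orientations of the facets. -/
def IsOrientable (T : SingularTriangulation) : Prop :=
  ∃ ε : T.Pentachoron → ℤˣ,
    ∀ s i, ε (T.adj s i) * Equiv.Perm.sign (T.glue s i) * ε s = -1

/-- No facet is paired with itself. -/
def NoSelfPairing (T : SingularTriangulation) : Prop :=
  ∀ s i, (T.adj s i, T.glue s i i) ≠ (s, i)

/-- A homeomorphism from `|T|` to a 4-manifold is PL if it is PL, in charts, on every pentachoron. -/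
def IsPLHomeo (T : SingularTriangulation) {M : Type*} [TopologicalSpace M]
    [ChartedSpace (EuclideanSpace ℝ (Fin 4)) M] (h : T.Space ≃ₜ M) : Prop :=
  ∀ (s : T.Pentachoron) (x : stdSimplex ℝ (Fin 5)),
    ∃ A : Set ((Fin 5 → ℝ) →ᵃ[ℝ] EuclideanSpace ℝ (Fin 4)), A.Finite ∧
      ∀ᶠ y in 𝓝 x, ∃ a ∈ A,
        chartAt (EuclideanSpace ℝ (Fin 4)) (h (T.proj s x)) (h (T.proj s y)) = a y

/-! ### Subdivisions -/

/-- The point with barycentric coordinates `x` with respect to the points `v 0, …, v 4`. -/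
def affineComb (v : Fin 5 → stdSimplex ℝ (Fin 5)) (x : stdSimplex ℝ (Fin 5)) :
    stdSimplex ℝ (Fin 5) :=
  ⟨∑ k, x k • (v k : Fin 5 → ℝ),
    (convex_stdSimplex ℝ (Fin 5)).sum_mem (fun k _ => x.2.1 k) x.2.2 fun k _ => (v k).2⟩

/-- `T'` is a subdivision of `T`: a homeomorphism `|T'| → |T|` which maps each pentachoron `s` of
`T'` affinely onto the 4-simplex with vertices `corner s 0, …, corner s 4` in the pentachoron
`carrier s` of `T`. -/
structure Subdivision (T' T : SingularTriangulation) where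
  homeo : T'.Space ≃ₜ T.Space
  carrier : T'.Pentachoron → T.Pentachoron
  corner : T'.Pentachoron → Fin 5 → stdSimplex ℝ (Fin 5)
  corner_independent : ∀ s, AffineIndependent ℝ fun k => (corner s k : Fin 5 → ℝ)
  homeo_proj : ∀ s x, homeo (T'.proj s x) = T.proj (carrier s) (affineComb (corner s) x)

/-! ### Tricolorings -/

/-- A partition of the vertices into three sets, given by its colour function, is a tricoloring if
each pentachoron has one vertex in one of the sets and two vertices in each of the other two. -/
def IsTricoloring (T : SingularTriangulation) (c : T.Vertex → Fin 3) : Prop :=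
  ∀ s, ∃ k : Fin 3, ∀ l : Fin 3,
    Nat.card {j : Fin 5 // c (T.vertex s j) = l} = if l = k then 1 else 2

/-- The monochromatic graph `Γ_k ⊆ |T|`: the union of the simplices all of whose vertices have
colour `k`; equivalently, the preimage of the vertex `k` under the map from `|T|` to the 2-simplex
which is induced by the colours and is linear on each simplex. -/
def monochromaticGraph (T : SingularTriangulation) (c : T.Vertex → Fin 3) (k : Fin 3) :
    Set T.Space :=
  {p | ∃ (s : T.Pentachoron) (x : stdSimplex ℝ (Fin 5)),
    p = T.proj s x ∧ ∀ j, x j ≠ 0 → c (T.vertex s j) = k}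

/-- The points of `|T|` which are vertices of colour `k`. -/
def monochromaticVertices (T : SingularTriangulation) (c : T.Vertex → Fin 3) (k : Fin 3) :
    Set T.Space :=
  {p | ∃ (s : T.Pentachoron) (j : Fin 5),
    p = T.proj s (stdSimplex.vertex j) ∧ c (T.vertex s j) = k}

end SingularTriangulation

end

/-! The barycentric subdivision cuts a pentachoron into 120 simplices, one for each ordering of its
vertices. Leaving out the barycentres of edges merges them in pairs: a piece is spanned by the two
ends of an edge and the barycentres of a triangle, a tetrahedron and the pentachoron of a flag
containing that edge, so there are 60. Colour the vertices of `T` with 0, the barycentres of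
tetrahedra and pentachora with 1, those of triangles with 2. Each piece then has 2 + 2 + 1 vertices.

Colours 0 and 1 still occur on every facet of a piece, so the monochromatic edges of adjacent pieces
meet; since the space is connected, any two pieces are joined by a chain of adjacent ones
(`reflTransGen_of_adj`), and these two graphs are connected. Colour 2 occurs once per piece, so its
graph is a finite set of points.

A piece corresponds to a pair of orderings differing by `swap01`, represented by its even member;
this makes orientations easy to follow. The main work is that |T'| → |T| is bijective. `flagPoint`
allows all orderings, and `flagPoint_eq_of_map_eq` reduces injectivity over a pentachoron to sorted
coordinates, whose stabilizer is generated by adjacent transpositions; `flagLift_eq_of_rel` makes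
the inverse compatible with the gluings of `T`. A continuous bijection from a compact space to a
Hausdorff space is then a homeomorphism. -/

noncomputable section

/-! ### Relabelling points of the standard simplex -/

lemma stdSimplex_map_perm_apply (g : Equiv.Perm (Fin 5)) (x : stdSimplex ℝ (Fin 5)) (i : Fin 5) :
    stdSimplex.map g x (g i) = x i := by
  rw [stdSimplex.map_coe, FunOnFinite.linearMap_apply_apply]
  simp [Finset.filter_eq']

lemma stdSimplex_map_perm_apply' (g : Equiv.Perm (Fin 5)) (x : stdSimplex ℝ (Fin 5)) (i : Fin 5) :
    stdSimplex.map g x i = x (g⁻¹ i) := by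
  rw [← stdSimplex_map_perm_apply g x (g⁻¹ i)]
  exact congrArg _ (g.apply_symm_apply i).symm

lemma stdSimplex_map_map_perm (g g' : Equiv.Perm (Fin 5)) (x : stdSimplex ℝ (Fin 5)) :
    stdSimplex.map g (stdSimplex.map g' x) = stdSimplex.map (g * g' : Equiv.Perm (Fin 5)) x :=
  stdSimplex.map_comp_apply _ _ _

lemma stdSimplex_map_one_perm (x : stdSimplex ℝ (Fin 5)) :
    stdSimplex.map (1 : Equiv.Perm (Fin 5)) x = x :=
  stdSimplex.map_id_apply x

lemma stdSimplex_map_swap_of_eq {i j : Fin 5} {x : stdSimplex ℝ (Fin 5)} (h : x i = x j) :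
    stdSimplex.map (Equiv.swap i j) x = x := by
  ext k
  rw [stdSimplex_map_perm_apply', Equiv.swap_inv]
  rcases eq_or_ne k i with rfl | hi
  · simp [h]
  rcases eq_or_ne k j with rfl | hj
  · simp [h]
  · rw [Equiv.swap_apply_of_ne_of_ne hi hj]

namespace SingularTriangulation

lemma affineComb_apply (v : Fin 5 → stdSimplex ℝ (Fin 5)) (x : stdSimplex ℝ (Fin 5)) (i : Fin 5) :
    affineComb v x i = ∑ k, x k * v k i := by
  change (∑ k, x k • (v k : Fin 5 → ℝ)) i = _
  simp only [Finset.sum_apply, Pi.smul_apply, smul_eq_mul]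

lemma affineComb_map (g : Equiv.Perm (Fin 5)) (v : Fin 5 → stdSimplex ℝ (Fin 5))
    (x : stdSimplex ℝ (Fin 5)) :
    affineComb (fun k => stdSimplex.map g (v k)) x = stdSimplex.map g (affineComb v x) := by
  ext i
  simp only [affineComb_apply, stdSimplex_map_perm_apply']

lemma continuous_affineComb (v : Fin 5 → stdSimplex ℝ (Fin 5)) : Continuous (affineComb v) := by
  refine Continuous.subtype_mk ?_ _
  refine continuous_finsetSum _ fun k _ => ?_
  exact ((continuous_apply k).comp continuous_subtype_val).smul continuous_const

/-! ### The model subdivision of a simplex -/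

/-- The transposition of the first two labels. -/
abbrev swap01 : Equiv.Perm (Fin 5) := Equiv.swap 0 1

/-- The vertices of a simplex of the model subdivision: two vertices of the pentachoron, and the
barycentres of a triangle, a tetrahedron and the pentachoron. -/
def flagCoord : Fin 5 → Fin 5 → ℝ :=
  ![![1, 0, 0, 0, 0], ![0, 1, 0, 0, 0], ![1/3, 1/3, 1/3, 0, 0], ![1/4, 1/4, 1/4, 1/4, 0],
    ![1/5, 1/5, 1/5, 1/5, 1/5]]

/-- The vertices `flagCoord` as points of the standard simplex. -/
def flagCorner (k : Fin 5) : stdSimplex ℝ (Fin 5) :=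
  ⟨flagCoord k, by
    constructor
    · intro i; fin_cases k <;> fin_cases i <;> simp [flagCoord]
    · fin_cases k <;> simp [flagCoord, Fin.sum_univ_five] <;> norm_num⟩

/-- The affine embedding of the standard simplex onto a simplex of the model subdivision. -/
def flagMap : stdSimplex ℝ (Fin 5) → stdSimplex ℝ (Fin 5) := affineComb flagCorner

lemma flagMap_coords (x : stdSimplex ℝ (Fin 5)) :
    flagMap x 0 = x 0 + x 2 / 3 + x 3 / 4 + x 4 / 5 ∧
    flagMap x 1 = x 1 + x 2 / 3 + x 3 / 4 + x 4 / 5 ∧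
    flagMap x 2 = x 2 / 3 + x 3 / 4 + x 4 / 5 ∧
    flagMap x 3 = x 3 / 4 + x 4 / 5 ∧ flagMap x 4 = x 4 / 5 := by
  have h (k i : Fin 5) : flagCorner k i = flagCoord k i := rfl
  simp only [flagMap, affineComb_apply, Fin.sum_univ_five, h]
  simp [flagCoord]
  refine ⟨?_, ?_, ?_, ?_, ?_⟩ <;> ring

lemma flagMap_injective : Function.Injective flagMap := by
  intro x y hxy
  obtain ⟨a0, a1, a2, a3, a4⟩ := flagMap_coords x
  obtain ⟨b0, b1, b2, b3, b4⟩ := flagMap_coords y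
  rw [hxy] at a0 a1 a2 a3 a4
  ext i
  fin_cases i <;> simp <;> linarith

/-- The model piece is symmetric in its two edge ends; hence orderings differing by `swap01` can
share a piece. -/
lemma flagMap_swap01 (x : stdSimplex ℝ (Fin 5)) :
    flagMap (stdSimplex.map swap01 x) = stdSimplex.map swap01 (flagMap x) := by
  obtain ⟨a0, a1, a2, a3, a4⟩ := flagMap_coords x
  obtain ⟨b0, b1, b2, b3, b4⟩ := flagMap_coords (stdSimplex.map swap01 x)
  have e2 : swap01 2 = 2 := by decide
  have e3 : swap01 3 = 3 := by decide
  have e4 : swap01 4 = 4 := by decide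
  simp only [stdSimplex_map_perm_apply', Equiv.swap_inv, Equiv.swap_apply_left,
    Equiv.swap_apply_right, e2, e3, e4] at b0 b1 b2 b3 b4
  ext i
  rw [stdSimplex_map_perm_apply', Equiv.swap_inv]
  fin_cases i <;> simp [e2, e3, e4] <;> linarith

lemma exists_flagMap_eq (y : stdSimplex ℝ (Fin 5)) :
    ∃ (g : Equiv.Perm (Fin 5)) (x : stdSimplex ℝ (Fin 5)),
      stdSimplex.map g (flagMap x) = y ∧ Antitone (flagMap x) := by
  obtain ⟨g, hg⟩ : ∃ g : Equiv.Perm (Fin 5), Antitone (y ∘ g) :=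
    ⟨Fin.revPerm.trans (Tuple.sort y),
      (Tuple.monotone_sort y).comp_antitone fun i j hij => Fin.rev_le_rev.2 hij⟩
  have h01 : y (g 1) ≤ y (g 0) := hg (by decide)
  have h12 : y (g 2) ≤ y (g 1) := hg (by decide)
  have h23 : y (g 3) ≤ y (g 2) := hg (by decide)
  have h34 : y (g 4) ≤ y (g 3) := hg (by decide)
  have h4 : 0 ≤ y (g 4) := stdSimplex.zero_le y _
  have hs : y (g 0) + y (g 1) + y (g 2) + y (g 3) + y (g 4) = 1 := by
    rw [← stdSimplex.sum_eq_one y, ← Equiv.sum_comp g, Fin.sum_univ_five]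
  -- Solution of the triangular system `flagMap_coords` for the sorted coordinates of `y`;
  -- sortedness makes the entries nonnegative.
  let x : stdSimplex ℝ (Fin 5) :=
    ⟨![y (g 0) - y (g 2), y (g 1) - y (g 2), 3 * (y (g 2) - y (g 3)), 4 * (y (g 3) - y (g 4)),
      5 * y (g 4)], by
      constructor
      · intro i; fin_cases i <;> simp <;> linarith
      · simp [Fin.sum_univ_five]; linarith⟩
  have x0 : x 0 = y (g 0) - y (g 2) := rfl
  have x1 : x 1 = y (g 1) - y (g 2) := rfl
  have x2 : x 2 = 3 * (y (g 2) - y (g 3)) := rfl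
  have x3 : x 3 = 4 * (y (g 3) - y (g 4)) := rfl
  have x4 : x 4 = 5 * y (g 4) := rfl
  have hx : (flagMap x : Fin 5 → ℝ) = y ∘ g := by
    obtain ⟨a0, a1, a2, a3, a4⟩ := flagMap_coords x
    ext i
    fin_cases i <;> simp <;> linarith
  refine ⟨g, x, ?_, hx ▸ hg⟩
  ext i
  rw [stdSimplex_map_perm_apply', hx]
  exact congrArg y (g.apply_symm_apply i)

lemma flagCoord_linearIndependent : LinearIndependent ℝ flagCoord := by
  rw [Fintype.linearIndependent_iff]
  intro c hc
  have h (i : Fin 5) := congrFun hc i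
  simp only [Finset.sum_apply, Fin.sum_univ_five, Pi.smul_apply, smul_eq_mul, Pi.zero_apply] at h
  have h0 := h 0
  have h1 := h 1
  have h2 := h 2
  have h3 := h 3
  have h4 := h 4
  simp [flagCoord] at h0 h1 h2 h3 h4
  intro i
  fin_cases i <;> simp <;> linarith

lemma affineIndependent_map_flagCorner (g : Equiv.Perm (Fin 5)) :
    AffineIndependent ℝ fun k => (stdSimplex.map g (flagCorner k) : Fin 5 → ℝ) := by
  have e : (fun k => (stdSimplex.map g (flagCorner k) : Fin 5 → ℝ)) =
      LinearMap.funLeft ℝ ℝ (g⁻¹ : Equiv.Perm (Fin 5)) ∘ flagCoord := by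
    ext k i
    exact stdSimplex_map_perm_apply' g _ i
  rw [e]
  exact (flagCoord_linearIndependent.map' (LinearMap.funLeft ℝ ℝ (g⁻¹ : Equiv.Perm (Fin 5)))
    (LinearMap.ker_eq_bot.2 (LinearMap.funLeft_injective_of_surjective ℝ ℝ _
      (Equiv.surjective _)))).affineIndependent

/-- A permutation fixing an antitone tuple is reached from the identity by adjacent transpositions
of equal entries. -/
lemma perm_induction_of_antitone {z : Fin 5 → ℝ} (hz : Antitone z)
    {p : Equiv.Perm (Fin 5) → Prop} (one : p 1)
    (swap : ∀ (g : Equiv.Perm (Fin 5)) (k : Fin 4), z k.castSucc = z k.succ →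
      p (g * Equiv.swap k.castSucc k.succ) → p g)
    (g : Equiv.Perm (Fin 5)) (hg : ∀ i, z (g i) = z i) : p g := by
  -- Undoing a descent of `g` strictly increases this sum. The bound 40 is crude: it is four times 0
  -- + 1 + 2 + 3 + 4.
  let m (g : Equiv.Perm (Fin 5)) : ℕ := ∑ i : Fin 5, (i : ℕ) * (g i : ℕ)
  have hm (g) : m g ≤ 40 := by
    simp only [m, Fin.sum_univ_five]
    have h (i) := (g i).isLt
    have := h 0; have := h 1; have := h 2; have := h 3; have := h 4
    simp; omega
  induction hn : 40 - m g using Nat.strong_induction_on generalizing g with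
  | _ n ih =>
  by_cases h1 : g = 1
  · rwa [h1]
  obtain ⟨k, hk⟩ : ∃ k : Fin 4, g k.succ < g k.castSucc := by
    by_contra! hcon
    exact h1 ((Equiv.Perm.monotone_iff g).1 (Fin.monotone_iff_le_succ.2 hcon))
  have hzk : z k.castSucc = z k.succ := by
    refine le_antisymm ?_ (hz (Fin.castSucc_lt_succ).le)
    rw [← hg k.castSucc, ← hg k.succ]
    exact hz hk.le
  have hlt : m g < m (g * Equiv.swap k.castSucc k.succ) := by
    have hk' : (g k.succ : ℕ) < g k.castSucc := hk
    simp only [m, Fin.sum_univ_five, Equiv.Perm.mul_apply]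
    fin_cases k <;> simp [Equiv.swap_apply_def] at hk' ⊢ <;> omega
  have := hm (g * Equiv.swap k.castSucc k.succ)
  refine swap g k hzk (ih _ ?_ _ ?_ rfl)
  · omega
  · intro i
    rw [Equiv.Perm.mul_apply, hg]
    rcases eq_or_ne i k.castSucc with rfl | hi
    · simp [hzk]
    rcases eq_or_ne i k.succ with rfl | hj
    · simp [hzk]
    · rw [Equiv.swap_apply_of_ne_of_ne hi hj]

/-! ### The subdivision into sixty pieces per pentachoron -/

/-- `1` for even permutations and `swap01` for odd ones. -/
def parityCorrection (g : Equiv.Perm (Fin 5)) : Equiv.Perm (Fin 5) :=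
  if Equiv.Perm.sign g = 1 then 1 else swap01

lemma sign_swap01 : Equiv.Perm.sign swap01 = -1 := Equiv.Perm.sign_swap (by decide)

lemma sign_parityCorrection (g : Equiv.Perm (Fin 5)) :
    Equiv.Perm.sign (parityCorrection g) = Equiv.Perm.sign g := by
  rw [parityCorrection]
  split_ifs with h
  · simp [h]
  · rw [sign_swap01, (Int.units_eq_one_or _).resolve_left h]

lemma parityCorrection_congr {g g' : Equiv.Perm (Fin 5)}
    (h : Equiv.Perm.sign g = Equiv.Perm.sign g') : parityCorrection g = parityCorrection g' := by
  simp only [parityCorrection, h]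

lemma parityCorrection_of_even {g : Equiv.Perm (Fin 5)} (h : Equiv.Perm.sign g = 1) :
    parityCorrection g = 1 := if_pos h

lemma parityCorrection_of_odd {g : Equiv.Perm (Fin 5)} (h : Equiv.Perm.sign g = -1) :
    parityCorrection g = swap01 := if_neg (by rw [h]; decide)

lemma parityCorrection_mul_self (g : Equiv.Perm (Fin 5)) :
    parityCorrection g * parityCorrection g = 1 := by
  rw [parityCorrection]
  split_ifs <;> simp

lemma parityCorrection_inv (g : Equiv.Perm (Fin 5)) :
    (parityCorrection g)⁻¹ = parityCorrection g :=
  inv_eq_of_mul_eq_one_left (parityCorrection_mul_self g)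

lemma parityCorrection_apply_four (g : Equiv.Perm (Fin 5)) : parityCorrection g 4 = 4 := by
  rw [parityCorrection]
  split_ifs <;> decide

lemma parityCorrection_mul_swap01 (g : Equiv.Perm (Fin 5)) :
    parityCorrection g * swap01 = swap01 * parityCorrection g := by
  rw [parityCorrection]
  split_ifs <;> simp

/-- The even permutation which agrees with `g` up to the order of the first two labels. -/
def evenPart (g : Equiv.Perm (Fin 5)) : alternatingGroup (Fin 5) :=
  ⟨g * parityCorrection g, by
    rw [Equiv.Perm.mem_alternatingGroup, Equiv.Perm.sign_mul, sign_parityCorrection]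
    exact Int.units_mul_self _⟩

lemma coe_evenPart (g : Equiv.Perm (Fin 5)) :
    (evenPart g : Equiv.Perm (Fin 5)) = g * parityCorrection g := rfl

lemma evenPart_mul_swap01 (g : Equiv.Perm (Fin 5)) : evenPart (g * swap01) = evenPart g := by
  apply Subtype.ext
  have hs : Equiv.Perm.sign (g * swap01) = -Equiv.Perm.sign g := by
    rw [Equiv.Perm.sign_mul, sign_swap01, mul_neg_one]
  rw [coe_evenPart, coe_evenPart]
  rcases Int.units_eq_one_or (Equiv.Perm.sign g) with h | h
  · rw [parityCorrection_of_even h, parityCorrection_of_odd (by rw [hs, h]), mul_assoc]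
    simp
  · rw [parityCorrection_of_odd h, parityCorrection_of_even (by rw [hs, h]; simp), mul_one]

/-- The relabellings which lead across the facets of a simplex of the model subdivision. The facet
opposite to the vertex `4` lies in the boundary. -/
def flagMove : Fin 5 → Equiv.Perm (Fin 5) :=
  -- Entries 2 and 3 change the triangle or the tetrahedron of the flag, entries 0 and 1 the edge
  -- inside the triangle. The factor `swap01` restores evenness and makes all inner gluings equal to
  -- `swap01`.
  ![swap01 * Equiv.swap 1 2, Equiv.swap 1 2 * swap01, Equiv.swap 2 3 * swap01,
    Equiv.swap 3 4 * swap01, 1]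

lemma flagMove_mem (j : Fin 5) : flagMove j ∈ alternatingGroup (Fin 5) := by
  rw [Equiv.Perm.mem_alternatingGroup]
  fin_cases j <;> decide

lemma flagMove_mul_flagMove {j : Fin 5} (hj : j ≠ 4) : flagMove j * flagMove (swap01 j) = 1 := by
  revert hj
  fin_cases j <;> decide

lemma swap01_ne_four {j : Fin 5} (hj : j ≠ 4) : swap01 j ≠ 4 := by
  revert j
  decide

/-- The subdivision of `T` along the flags edge, triangle, tetrahedron of each pentachoron: it has
one pentachoron for each pentachoron `s` of `T` and each even ordering of the vertices of `s`. -/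
def flagSubdivision (T : SingularTriangulation) : SingularTriangulation where
  Pentachoron := T.Pentachoron × alternatingGroup (Fin 5)
  adj t j := if j = 4 then (T.adj t.1 (t.2.1 4), evenPart (T.glue t.1 (t.2.1 4) * t.2.1))
    else (t.1, t.2 * ⟨flagMove j, flagMove_mem j⟩)
  -- The labels must follow the exchange of edge ends that `evenPart` may introduce.
  glue t j := if j = 4 then parityCorrection (T.glue t.1 (t.2.1 4)) else swap01
  adj_adj := by
    rintro ⟨s, σ⟩ j
    by_cases hj : j = 4
    · subst hj
      have hσ := Equiv.Perm.mem_alternatingGroup.1 σ.2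
      have he : (evenPart (T.glue s (σ.1 4) * σ.1)).1 4 = T.glue s (σ.1 4) (σ.1 4) := by
        rw [coe_evenPart, Equiv.Perm.mul_apply, parityCorrection_apply_four]
        rfl
      simp only [if_true, parityCorrection_apply_four, he, T.adj_adj, T.glue_glue]
      refine Prod.ext rfl (Subtype.ext ?_)
      rw [coe_evenPart, coe_evenPart]
      dsimp only
      have h1 : parityCorrection (T.glue s (σ.1 4) * σ.1) =
          parityCorrection (T.glue s (σ.1 4)) :=
        parityCorrection_congr (by rw [Equiv.Perm.sign_mul, hσ, mul_one])
      rw [h1, mul_assoc _ σ.1, inv_mul_cancel_left,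
        parityCorrection_congr (g := σ.1 * _) (g' := T.glue s (σ.1 4)), mul_assoc,
        parityCorrection_mul_self, mul_one]
      rw [Equiv.Perm.sign_mul, hσ, one_mul, sign_parityCorrection]
    · simp only [if_neg hj, if_neg (swap01_ne_four hj)]
      refine Prod.ext rfl (Subtype.ext ?_)
      simp only [Subgroup.coe_mul]
      rw [mul_assoc, flagMove_mul_flagMove hj, mul_one]
  glue_glue := by
    rintro ⟨s, σ⟩ j
    by_cases hj : j = 4
    · subst hj
      have he : (evenPart (T.glue s (σ.1 4) * σ.1)).1 4 = T.glue s (σ.1 4) (σ.1 4) := by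
        rw [coe_evenPart, Equiv.Perm.mul_apply, parityCorrection_apply_four]
        rfl
      simp only [if_true, parityCorrection_apply_four, he, T.glue_glue]
      rw [parityCorrection_inv]
      exact parityCorrection_congr (Equiv.Perm.sign_inv _)
    · simp only [if_neg hj, if_neg (swap01_ne_four hj), Equiv.swap_inv]

variable {T : SingularTriangulation}

/-- The pentachoron of `flagSubdivision` given by `s` and an even ordering of its vertices. -/
def flagPiece (s : T.Pentachoron) (σ : alternatingGroup (Fin 5)) : T.flagSubdivision.Pentachoron :=
  (s, σ)

lemma exists_flagPiece_eq (t : T.flagSubdivision.Pentachoron) :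
    ∃ (s : T.Pentachoron) (σ : alternatingGroup (Fin 5)), flagPiece s σ = t := ⟨t.1, t.2, rfl⟩

lemma flagSubdivision_adj_four (s : T.Pentachoron) (σ : alternatingGroup (Fin 5)) :
    T.flagSubdivision.adj (flagPiece s σ) 4 =
      flagPiece (T.adj s (σ.1 4)) (evenPart (T.glue s (σ.1 4) * σ.1)) := rfl

lemma flagSubdivision_glue_four (s : T.Pentachoron) (σ : alternatingGroup (Fin 5)) :
    T.flagSubdivision.glue (flagPiece s σ) 4 = parityCorrection (T.glue s (σ.1 4)) := rfl

lemma flagSubdivision_adj_of_ne (s : T.Pentachoron) (σ : alternatingGroup (Fin 5)) {j : Fin 5}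
    (hj : j ≠ 4) :
    T.flagSubdivision.adj (flagPiece s σ) j = flagPiece s (σ * ⟨flagMove j, flagMove_mem j⟩) :=
  if_neg hj

lemma flagSubdivision_glue_of_ne (s : T.Pentachoron) (σ : alternatingGroup (Fin 5)) {j : Fin 5}
    (hj : j ≠ 4) : T.flagSubdivision.glue (flagPiece s σ) j = swap01 := if_neg hj

/-- Even orderings inherit the orientation of `s`. Inner gluings are the odd `swap01` between pieces
of equal sign, and outer gluings have the sign of the gluing in `T`. -/
lemma IsOrientable.flagSubdivision (hT : T.IsOrientable) : T.flagSubdivision.IsOrientable := by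
  obtain ⟨ε, hε⟩ := hT
  refine ⟨fun t => ε t.1, ?_⟩
  intro t j
  obtain ⟨s, σ, rfl⟩ := exists_flagPiece_eq t
  by_cases hj : j = 4
  · subst hj
    rw [flagSubdivision_adj_four, flagSubdivision_glue_four, sign_parityCorrection]
    exact hε s _
  · rw [flagSubdivision_adj_of_ne s σ hj, flagSubdivision_glue_of_ne s σ hj, sign_swap01]
    change ε s * -1 * ε s = -1
    simp

lemma flagMove_ne_one {j : Fin 5} (hj : j ≠ 4) : flagMove j ≠ 1 := by
  revert hj
  fin_cases j <;> decide

/-- An inner move changes the ordering. If an outer facet led back to its own piece, comparing the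
orderings at label 4 would give a self-paired facet of `T`. -/
lemma NoSelfPairing.flagSubdivision (hT : T.NoSelfPairing) :
    T.flagSubdivision.NoSelfPairing := by
  intro t j h
  obtain ⟨s, σ, rfl⟩ := exists_flagPiece_eq t
  rw [Prod.ext_iff] at h
  by_cases hj : j = 4
  · subst hj
    rw [flagSubdivision_adj_four] at h
    have h1 : T.adj s (σ.1 4) = s := congrArg Prod.fst h.1
    have h2 : T.glue s (σ.1 4) * σ.1 * parityCorrection _ = σ.1 :=
      congrArg (fun t : T.Pentachoron × alternatingGroup (Fin 5) => t.2.1) h.1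
    have h3 := DFunLike.congr_fun h2 4
    rw [Equiv.Perm.mul_apply, parityCorrection_apply_four, Equiv.Perm.mul_apply] at h3
    exact hT s (σ.1 4) (Prod.ext h1 h3)
  · rw [flagSubdivision_adj_of_ne s σ hj] at h
    have h2 : σ.1 * flagMove j = σ.1 :=
      congrArg (fun t : T.Pentachoron × alternatingGroup (Fin 5) => t.2.1) h.1
    exact flagMove_ne_one hj (mul_eq_left.1 h2)

/-! ### Points of the subdivision for arbitrary orderings -/

lemma proj_eq_of_apply_eq_zero (T : SingularTriangulation) (s : T.Pentachoron) {i : Fin 5}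
    {x : stdSimplex ℝ (Fin 5)} (hx : x i = 0) :
    T.proj s x = T.proj (T.adj s i) (stdSimplex.map (T.glue s i) x) :=
  Quot.sound (PointRel.glue s i x hx)

/-- The point with coordinates `x` in the piece of `flagSubdivision` which is given by a possibly
odd ordering `g` of the vertices of `s`. -/
def flagPoint (T : SingularTriangulation) (s : T.Pentachoron) (g : Equiv.Perm (Fin 5))
    (x : stdSimplex ℝ (Fin 5)) : T.flagSubdivision.Space :=
  T.flagSubdivision.proj (flagPiece s (evenPart g)) (stdSimplex.map (parityCorrection g) x)

lemma flagPoint_of_even (s : T.Pentachoron) (σ : alternatingGroup (Fin 5))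
    (x : stdSimplex ℝ (Fin 5)) : T.flagPoint s σ.1 x = T.flagSubdivision.proj (flagPiece s σ) x := by
  have h := parityCorrection_of_even (Equiv.Perm.mem_alternatingGroup.1 σ.2)
  have h' : evenPart σ.1 = σ := Subtype.ext (by rw [coe_evenPart, h, mul_one])
  rw [flagPoint, h, h', stdSimplex_map_one_perm]

lemma flagPoint_mul_swap01 (s : T.Pentachoron) (g : Equiv.Perm (Fin 5))
    (x : stdSimplex ℝ (Fin 5)) :
    T.flagPoint s (g * swap01) (stdSimplex.map swap01 x) = T.flagPoint s g x := by
  rw [flagPoint, flagPoint, evenPart_mul_swap01, stdSimplex_map_map_perm]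
  congr 3
  have h := congrArg Subtype.val (evenPart_mul_swap01 g)
  rw [coe_evenPart, coe_evenPart, mul_assoc, mul_right_inj] at h
  rw [← h, parityCorrection_mul_swap01]

lemma flagPoint_eq_proj_of_odd (s : T.Pentachoron) {g : Equiv.Perm (Fin 5)}
    (hg : Equiv.Perm.sign g = -1) (x : stdSimplex ℝ (Fin 5)) :
    T.flagPoint s g x = T.flagSubdivision.proj (flagPiece s (evenPart g)) (stdSimplex.map swap01 x) := by
  rw [flagPoint, parityCorrection_of_odd hg]

/-- Crossing an inner facet of the subdivision. -/
lemma flagPoint_mul_swap (s : T.Pentachoron) (g : Equiv.Perm (Fin 5)) {k : Fin 4} (hk : k ≠ 0)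
    {x : stdSimplex ℝ (Fin 5)} (hx : x k.castSucc = 0) :
    T.flagPoint s (g * Equiv.swap k.castSucc k.succ) x = T.flagPoint s g x := by
  have hk4 : k.castSucc ≠ 4 := Fin.castSucc_ne_last k
  have hsign : Equiv.Perm.sign (Equiv.swap k.castSucc k.succ) = -1 :=
    Equiv.Perm.sign_swap (Fin.castSucc_lt_succ).ne
  have key (σ : alternatingGroup (Fin 5)) :
      T.flagPoint s (σ.1 * Equiv.swap k.castSucc k.succ) x = T.flagPoint s σ.1 x := by
    have hσ := Equiv.Perm.mem_alternatingGroup.1 σ.2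
    have hodd : Equiv.Perm.sign (σ.1 * Equiv.swap k.castSucc k.succ) = -1 := by
      rw [Equiv.Perm.sign_mul, hσ, hsign, one_mul]
    rw [flagPoint_of_even, flagPoint_eq_proj_of_odd s hodd, proj_eq_of_apply_eq_zero _ _ hx,
      flagSubdivision_adj_of_ne s σ hk4, flagSubdivision_glue_of_ne s σ hk4]
    congr 2
    apply Subtype.ext
    rw [coe_evenPart, parityCorrection_of_odd hodd, Subgroup.coe_mul, mul_assoc]
    congr 1
    revert hk
    fin_cases k <;> decide
  rcases Int.units_eq_one_or (Equiv.Perm.sign g) with h | h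
  · exact key ⟨g, Equiv.Perm.mem_alternatingGroup.2 h⟩
  -- For odd `g` the transposed ordering is even, and the identity is read backwards.
  · have h' := key ⟨g * Equiv.swap k.castSucc k.succ, by
      rw [Equiv.Perm.mem_alternatingGroup, Equiv.Perm.sign_mul, h, hsign]; rfl⟩
    simp only [mul_assoc, Equiv.swap_mul_self, mul_one] at h'
    exact h'.symm

/-- Crossing a boundary facet of the subdivided pentachoron. -/
lemma flagPoint_glue (s : T.Pentachoron) (g : Equiv.Perm (Fin 5))
    {x : stdSimplex ℝ (Fin 5)} (hx : x 4 = 0) :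
    T.flagPoint (T.adj s (g 4)) (T.glue s (g 4) * g) x = T.flagPoint s g x := by
  have key (σ : alternatingGroup (Fin 5)) {x : stdSimplex ℝ (Fin 5)} (hx : x 4 = 0) :
      T.flagPoint (T.adj s (σ.1 4)) (T.glue s (σ.1 4) * σ.1) x = T.flagPoint s σ.1 x := by
    rw [flagPoint_of_even, proj_eq_of_apply_eq_zero _ _ hx, flagSubdivision_adj_four,
      flagSubdivision_glue_four, flagPoint]
    congr 3
    refine parityCorrection_congr ?_
    rw [Equiv.Perm.sign_mul, Equiv.Perm.mem_alternatingGroup.1 σ.2, mul_one]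
  rcases Int.units_eq_one_or (Equiv.Perm.sign g) with h | h
  · exact key ⟨g, Equiv.Perm.mem_alternatingGroup.2 h⟩ hx
  · have e4 : swap01 4 = 4 := by decide
    have h' := key ⟨g * swap01, by
      rw [Equiv.Perm.mem_alternatingGroup, Equiv.Perm.sign_mul, h, sign_swap01]; rfl⟩
      (x := stdSimplex.map swap01 x) (by rw [stdSimplex_map_perm_apply', Equiv.swap_inv, e4, hx])
    rw [flagPoint_mul_swap01] at h'
    simp only [Equiv.Perm.mul_apply, e4] at h'
    rwa [← mul_assoc, flagPoint_mul_swap01] at h'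

/-! ### The homeomorphism -/

/-- For `k = 0` the wall `x 0 = x 1` runs through the inside of a piece, and the transposition only
renames the edge ends. For the other `k` equality says that `x` lies on the inner facet opposite to
`k`. -/
lemma flagPoint_mul_swap_of_flagMap_eq (s : T.Pentachoron) (g : Equiv.Perm (Fin 5)) {k : Fin 4}
    {x : stdSimplex ℝ (Fin 5)} (hx : flagMap x k.castSucc = flagMap x k.succ) :
    T.flagPoint s (g * Equiv.swap k.castSucc k.succ) x = T.flagPoint s g x := by
  obtain ⟨a0, a1, a2, a3, a4⟩ := flagMap_coords x
  by_cases hk : k = 0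
  · subst hk
    have h01 : x 0 = x 1 := by
      change flagMap x 0 = flagMap x 1 at hx
      linarith
    have h := flagPoint_mul_swap01 s g x
    rwa [stdSimplex_map_swap_of_eq h01] at h
  · refine flagPoint_mul_swap s g hk ?_
    fin_cases k
    · exact absurd rfl hk
    · change flagMap x 1 = flagMap x 2 at hx
      change x 1 = 0
      linarith
    · change flagMap x 2 = flagMap x 3 at hx
      change x 2 = 0
      linarith
    · change flagMap x 3 = flagMap x 4 at hx
      change x 3 = 0
      linarith

/-- The permutation factors into adjacent transpositions of equal entries, each of which crosses a
wall containing the point. -/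
lemma flagPoint_mul_of_antitone (s : T.Pentachoron) (g : Equiv.Perm (Fin 5))
    {x : stdSimplex ℝ (Fin 5)} (hx : Antitone (flagMap x)) (p : Equiv.Perm (Fin 5))
    (hp : ∀ i, flagMap x (p i) = flagMap x i) :
    T.flagPoint s (g * p) x = T.flagPoint s g x := by
  refine perm_induction_of_antitone (p := fun p => T.flagPoint s (g * p) x = T.flagPoint s g x)
    hx (by rw [mul_one]) (fun p k hk h => ?_) p hp
  rw [← h, ← mul_assoc, flagPoint_mul_swap_of_flagMap_eq s (g * p) hk]

/-- Every point in a piece can be moved so that its flag coordinates are sorted. -/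
lemma exists_antitone_flagPoint_eq (s : T.Pentachoron) (g : Equiv.Perm (Fin 5))
    (x : stdSimplex ℝ (Fin 5)) :
    ∃ (g' : Equiv.Perm (Fin 5)) (x' : stdSimplex ℝ (Fin 5)), Antitone (flagMap x') ∧
      T.flagPoint s g' x' = T.flagPoint s g x ∧
      stdSimplex.map g' (flagMap x') = stdSimplex.map g (flagMap x) := by
  -- Nonnegativity of `x` gives every inequality except the first.
  have key (x : stdSimplex ℝ (Fin 5)) (h : x 1 ≤ x 0) : Antitone (flagMap x) := by
    obtain ⟨a0, a1, a2, a3, a4⟩ := flagMap_coords x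
    have h0 (i : Fin 5) := stdSimplex.zero_le x i
    have := h0 0
    have := h0 1
    have := h0 2
    have := h0 3
    have := h0 4
    refine Fin.antitone_iff_succ_le.2 fun k => ?_
    fin_cases k
    · change flagMap x 1 ≤ flagMap x 0
      linarith
    · change flagMap x 2 ≤ flagMap x 1
      linarith
    · change flagMap x 3 ≤ flagMap x 2
      linarith
    · change flagMap x 4 ≤ flagMap x 3
      linarith
  rcases le_total (x 1) (x 0) with h | h
  · exact ⟨g, x, key x h, rfl, rfl⟩
  · refine ⟨g * swap01, stdSimplex.map swap01 x, key _ ?_, flagPoint_mul_swap01 s g x, ?_⟩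
    · simpa only [stdSimplex_map_perm_apply', Equiv.swap_inv, Equiv.swap_apply_left,
        Equiv.swap_apply_right] using h
    · rw [flagMap_swap01, stdSimplex_map_map_perm, mul_assoc, Equiv.swap_mul_self, mul_one]

/-- A point of the subdivision is determined by its image in the pentachoron. -/
lemma flagPoint_eq_of_map_eq (s : T.Pentachoron) {g g' : Equiv.Perm (Fin 5)}
    {x x' : stdSimplex ℝ (Fin 5)}
    (h : stdSimplex.map g (flagMap x) = stdSimplex.map g' (flagMap x')) :
    T.flagPoint s g x = T.flagPoint s g' x' := by
  obtain ⟨g₁, x₁, hx₁, e₁, m₁⟩ := exists_antitone_flagPoint_eq s g x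
  obtain ⟨g₂, x₂, hx₂, e₂, m₂⟩ := exists_antitone_flagPoint_eq s g' x'
  rw [← e₁, ← e₂]
  rw [← m₁, ← m₂] at h
  set y := stdSimplex.map g₁ (flagMap x₁) with hy
  have c₁ : (y : Fin 5 → ℝ) ∘ g₁ = flagMap x₁ := by
    ext i
    exact stdSimplex_map_perm_apply _ _ _
  have c₂ : (y : Fin 5 → ℝ) ∘ g₂ = flagMap x₂ := by
    ext i
    rw [h]
    exact stdSimplex_map_perm_apply _ _ _
  -- Two decreasing rearrangements of `y` coincide, so `g₁` and `g₂` differ by a permutation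
  -- preserving the sorted tuple.
  have c : (y : Fin 5 → ℝ) ∘ g₁ = y ∘ g₂ :=
    Tuple.unique_antitone (c₁ ▸ hx₁) (c₂ ▸ hx₂)
  have hx : x₁ = x₂ := flagMap_injective (DFunLike.coe_injective (by rw [← c₁, ← c₂, c]))
  subst hx
  have hp := flagPoint_mul_of_antitone s g₂ hx₁ (g₂⁻¹ * g₁) fun i => by
    rw [← c₂, Function.comp_apply, Function.comp_apply, ← Equiv.Perm.mul_apply,
      mul_inv_cancel_left]
    exact congrFun c i
  rwa [mul_inv_cancel_left] at hp

/-- The map `|T'| → |T|` for the subdivision `T' = flagSubdivision T`, on the pieces. -/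
def flagCarrierPoint (T : SingularTriangulation) (p : T.flagSubdivision.Pieces) : T.Space :=
  T.proj p.1.1 (stdSimplex.map p.1.2.1 (flagMap p.2))

/-- On an inner facet two flag coordinates agree, and up to `swap01` the move only exchanges them.
For `j = 0` these are coordinates 0 and 2, which `swap01` brings to positions 1 and 2. -/
lemma map_flagMove_of_apply_eq_zero {j : Fin 5} (hj : j ≠ 4) {x : stdSimplex ℝ (Fin 5)}
    (hx : x j = 0) :
    stdSimplex.map (flagMove j) (flagMap (stdSimplex.map swap01 x)) = flagMap x := by
  obtain ⟨a0, a1, a2, a3, a4⟩ := flagMap_coords x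
  have key {k : Fin 4} (h : flagMap x k.castSucc = flagMap x k.succ) :
      stdSimplex.map (Equiv.swap k.castSucc k.succ * swap01 : Equiv.Perm (Fin 5))
        (stdSimplex.map swap01 (flagMap x)) = flagMap x := by
    rw [stdSimplex_map_map_perm, mul_assoc, Equiv.swap_mul_self, mul_one,
      stdSimplex_map_swap_of_eq h]
  rw [flagMap_swap01]
  fin_cases j
  · change x 0 = 0 at hx
    change stdSimplex.map (swap01 * Equiv.swap 1 2 : Equiv.Perm (Fin 5)) _ = _
    have h02 : flagMap x 0 = flagMap x 2 := by linarith
    rw [← stdSimplex_map_map_perm, stdSimplex_map_swap_of_eq (i := 1) (j := 2),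
      stdSimplex_map_map_perm, Equiv.swap_mul_self, stdSimplex_map_one_perm]
    rw [stdSimplex_map_perm_apply', stdSimplex_map_perm_apply']
    exact h02
  · change x 1 = 0 at hx
    exact key (k := 1) (show flagMap x 1 = flagMap x 2 by linarith)
  · change x 2 = 0 at hx
    exact key (k := 2) (show flagMap x 2 = flagMap x 3 by linarith)
  · change x 3 = 0 at hx
    exact key (k := 3) (show flagMap x 3 = flagMap x 4 by linarith)
  · exact absurd rfl hj

lemma flagMap_map_parityCorrection (g : Equiv.Perm (Fin 5)) (x : stdSimplex ℝ (Fin 5)) :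
    flagMap (stdSimplex.map (parityCorrection g) x) =
      stdSimplex.map (parityCorrection g) (flagMap x) := by
  rw [parityCorrection]
  split_ifs
  · rw [stdSimplex_map_one_perm, stdSimplex_map_one_perm]
  · exact flagMap_swap01 x

/-- The facet opposite to label 4 lies in the facet of `s` opposite to `σ 4`, where the gluing of
`T` applies and the two parity corrections cancel. -/
lemma flagCarrierPoint_eq_of_rel (p q : T.flagSubdivision.Pieces)
    (h : T.flagSubdivision.PointRel p q) : T.flagCarrierPoint p = T.flagCarrierPoint q := by
  obtain ⟨t, j, x, hx⟩ := h
  obtain ⟨s, σ, rfl⟩ := exists_flagPiece_eq t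
  by_cases hj : j = 4
  · subst hj
    rw [flagSubdivision_adj_four, flagSubdivision_glue_four]
    change T.proj s (stdSimplex.map σ.1 (flagMap x)) =
      T.proj (T.adj s (σ.1 4)) (stdSimplex.map
        (T.glue s (σ.1 4) * σ.1 * parityCorrection (T.glue s (σ.1 4) * σ.1) : Equiv.Perm (Fin 5))
        (flagMap (stdSimplex.map (parityCorrection (T.glue s (σ.1 4))) x)))
    have h4 : stdSimplex.map σ.1 (flagMap x) (σ.1 4) = 0 := by
      rw [stdSimplex_map_perm_apply, (flagMap_coords x).2.2.2.2, hx, zero_div]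
    rw [proj_eq_of_apply_eq_zero T s h4, flagMap_map_parityCorrection,
      parityCorrection_congr (g := T.glue s (σ.1 4) * σ.1) (g' := T.glue s (σ.1 4)),
      stdSimplex_map_map_perm, stdSimplex_map_map_perm, mul_assoc _ (parityCorrection _),
      parityCorrection_mul_self, mul_one]
    rw [Equiv.Perm.sign_mul, Equiv.Perm.mem_alternatingGroup.1 σ.2, mul_one]
  · rw [flagSubdivision_adj_of_ne s σ hj, flagSubdivision_glue_of_ne s σ hj]
    change T.proj s (stdSimplex.map σ.1 (flagMap x)) =
      T.proj s (stdSimplex.map (σ.1 * flagMove j : Equiv.Perm (Fin 5))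
        (flagMap (stdSimplex.map swap01 x)))
    rw [← stdSimplex_map_map_perm, map_flagMove_of_apply_eq_zero hj hx]

/-- The map `|T'| → |T|` for the subdivision `T' = flagSubdivision T`. -/
def flagSpaceMap (T : SingularTriangulation) : T.flagSubdivision.Space → T.Space :=
  Quot.lift T.flagCarrierPoint flagCarrierPoint_eq_of_rel

lemma flagSpaceMap_flagPoint (s : T.Pentachoron) (g : Equiv.Perm (Fin 5))
    (x : stdSimplex ℝ (Fin 5)) :
    T.flagSpaceMap (T.flagPoint s g x) = T.proj s (stdSimplex.map g (flagMap x)) := by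
  change T.proj s (stdSimplex.map (g * parityCorrection g : Equiv.Perm (Fin 5))
    (flagMap (stdSimplex.map (parityCorrection g) x))) = _
  rw [flagMap_map_parityCorrection, stdSimplex_map_map_perm, mul_assoc, parityCorrection_mul_self,
    mul_one]

lemma continuous_proj (T : SingularTriangulation) (s : T.Pentachoron) : Continuous (T.proj s) :=
  continuous_quot_mk.comp continuous_sigmaMk

instance instCompactSpaceSpace (T : SingularTriangulation) : CompactSpace T.Space := by
  change CompactSpace (Quot T.PointRel)
  infer_instance

lemma continuous_flagSpaceMap (T : SingularTriangulation) : Continuous T.flagSpaceMap := by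
  refine continuous_quot_lift _ (continuous_sigma fun t => ?_)
  exact (T.continuous_proj t.1).comp
    ((stdSimplex.continuous_map t.2.1).comp (continuous_affineComb flagCorner))

/-- A preimage of a point of a pentachoron under `flagSpaceMap`. -/
def flagLift (T : SingularTriangulation) (p : T.Pieces) : T.flagSubdivision.Space :=
  T.flagPoint p.1 (exists_flagMap_eq p.2).choose (exists_flagMap_eq p.2).choose_spec.choose

lemma flagLift_eq (s : T.Pentachoron) {g : Equiv.Perm (Fin 5)} {x y : stdSimplex ℝ (Fin 5)}
    (h : stdSimplex.map g (flagMap x) = y) : T.flagLift ⟨s, y⟩ = T.flagPoint s g x :=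
  flagPoint_eq_of_map_eq s ((exists_flagMap_eq y).choose_spec.choose_spec.1.trans h.symm)

lemma flagLift_eq_of_rel (p q : T.Pieces) (h : T.PointRel p q) :
    T.flagLift p = T.flagLift q := by
  obtain ⟨s, i, y, hy⟩ := h
  obtain ⟨g, x, hgx, hx⟩ := exists_flagMap_eq y
  have hg (j : Fin 5) : flagMap x j = y (g j) := by rw [← hgx, stdSimplex_map_perm_apply]
  have h4 : flagMap x 4 = 0 := by
    refine le_antisymm ?_ (stdSimplex.zero_le _ _)
    have hi : flagMap x (g⁻¹ i) = 0 := by rw [← stdSimplex_map_perm_apply', hgx, hy]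
    exact hi ▸ hx (Fin.le_last _)
  have hx4 : x 4 = 0 := by linarith [(flagMap_coords x).2.2.2.2]
  -- Sorting need not put `i` last, but the coordinates `i` and `g 4` of `y` both vanish and may be
  -- exchanged.
  obtain ⟨g', hg', hg'4⟩ : ∃ g' : Equiv.Perm (Fin 5),
      stdSimplex.map g' (flagMap x) = y ∧ g' 4 = i := by
    refine ⟨Equiv.swap i (g 4) * g, ?_, by simp⟩
    rw [← stdSimplex_map_map_perm, hgx, stdSimplex_map_swap_of_eq]
    rw [hy, ← hg, h4]
  rw [flagLift_eq s hg', flagLift_eq (T.adj s i) (g := T.glue s i * g') (x := x)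
    (by rw [← stdSimplex_map_map_perm, hg']), ← hg'4, flagPoint_glue s g' hx4]

lemma bijective_flagSpaceMap (T : SingularTriangulation) : Function.Bijective T.flagSpaceMap := by
  refine Function.bijective_iff_has_inverse.2 ⟨Quot.lift T.flagLift flagLift_eq_of_rel, ?_, ?_⟩
  · rintro ⟨t, x⟩
    obtain ⟨s, σ, rfl⟩ := exists_flagPiece_eq t
    exact (flagLift_eq s rfl).trans (flagPoint_of_even s σ x)
  · rintro ⟨s, y⟩
    obtain ⟨g, x, hgx, -⟩ := exists_flagMap_eq y
    change T.flagSpaceMap (T.flagLift ⟨s, y⟩) = T.proj s y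
    rw [flagLift_eq s hgx, flagSpaceMap_flagPoint, hgx]

/-- `flagSubdivision` is a subdivision. -/
def subdivisionFlagSubdivision (T : SingularTriangulation) [T2Space T.Space] :
    Subdivision T.flagSubdivision T where
  homeo := (continuous_flagSpaceMap T).homeoOfEquivCompactToT2
    (f := Equiv.ofBijective _ (bijective_flagSpaceMap T))
  carrier t := t.1
  corner t k := stdSimplex.map t.2.1 (flagCorner k)
  corner_independent t := affineIndependent_map_flagCorner t.2.1
  homeo_proj t x := by
    rw [affineComb_map]
    rfl

lemma card_flagSubdivision (T : SingularTriangulation) :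
    Nat.card T.flagSubdivision.Pentachoron = 60 * Nat.card T.Pentachoron := by
  change Nat.card (T.Pentachoron × alternatingGroup (Fin 5)) = _
  rw [Nat.card_prod, nat_card_alternatingGroup, Nat.card_fin, mul_comm]
  rfl

lemma card_carrier_eq (T : SingularTriangulation) [T2Space T.Space] (s : T.Pentachoron) :
    Nat.card {t : T.flagSubdivision.Pentachoron //
      T.subdivisionFlagSubdivision.carrier t = s} = 60 := by
  have e : {t : T.flagSubdivision.Pentachoron // T.subdivisionFlagSubdivision.carrier t = s} ≃
      alternatingGroup (Fin 5) :=
    { toFun := fun t => t.1.2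
      invFun := fun σ => ⟨(s, σ), rfl⟩
      left_inv := by rintro ⟨⟨_, σ⟩, rfl⟩; rfl
      right_inv := fun σ => rfl }
  rw [Nat.card_congr e, nat_card_alternatingGroup, Nat.card_fin]
  rfl

/-- A subdivision of a PL triangulation is PL. -/
lemma Subdivision.isPLHomeo {T' T : SingularTriangulation} (φ : Subdivision T' T) {M : Type*}
    [TopologicalSpace M] [ChartedSpace (EuclideanSpace ℝ (Fin 4)) M] {h : T.Space ≃ₜ M}
    (hh : T.IsPLHomeo h) : T'.IsPLHomeo (φ.homeo.trans h) := by
  intro t x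
  obtain ⟨A, hA, hA'⟩ := hh (φ.carrier t) (affineComb (φ.corner t) x)
  -- Linear extension of `affineComb`, to be composed with the affine pieces of `h`.
  let L : (Fin 5 → ℝ) →ᵃ[ℝ] (Fin 5 → ℝ) :=
    (Fintype.linearCombination ℝ fun k => (φ.corner t k : Fin 5 → ℝ)).toAffineMap
  refine ⟨(fun a => a.comp L) '' A, hA.image _, ?_⟩
  filter_upwards [(continuous_affineComb (φ.corner t)).continuousAt.eventually hA']
    with y ⟨a, ha, hy⟩
  refine ⟨_, ⟨a, ha, rfl⟩, ?_⟩
  simp only [Homeomorph.trans_apply, φ.homeo_proj]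
  exact hy

/-! ### Connectedness of the dual graph -/

/-- Sending each pentachoron to its class gives a continuous map from |T| to a discrete space, which
is constant. -/
lemma reflTransGen_of_adj [PreconnectedSpace T.Space] {r : T.Pentachoron → T.Pentachoron → Prop}
    [Std.Symm r] (h : ∀ s i, r s (T.adj s i)) (s s' : T.Pentachoron) :
    Relation.ReflTransGen r s s' := by
  rw [← Relation.EqvGen.eqvGen_eq_reflTransGen]
  refine Quot.eqvGen_exact ?_
  let _ : TopologicalSpace (Quot r) := ⊥
  have _ : DiscreteTopology (Quot r) := ⟨rfl⟩
  let f : T.Space → Quot r := Quot.lift (fun p => Quot.mk r p.1) (by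
    rintro _ _ ⟨s, i, x, hx⟩
    exact Quot.sound (h s i))
  have hf : Continuous f :=
    continuous_quot_lift _ (continuous_sigma fun s => continuous_const (y := Quot.mk r s))
  exact PreconnectedSpace.constant ‹_› hf (x := T.proj s (stdSimplex.vertex 0))
    (y := T.proj s' (stdSimplex.vertex 0))

/-! ### Monochromatic graphs of colourings by labels -/

lemma isPreconnected_face (p : Fin 5 → Prop) :
    IsPreconnected {x : stdSimplex ℝ (Fin 5) | ∀ j, x j ≠ 0 → p j} := by
  rw [← Topology.IsInducing.subtypeVal.isPreconnected_image]
  refine Convex.isPreconnected ?_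
  rintro _ ⟨x, hx, rfl⟩ _ ⟨y, hy, rfl⟩ a b ha hb hab
  refine ⟨⟨_, convex_stdSimplex ℝ (Fin 5) x.2 y.2 ha hb hab⟩, fun j hj => ?_, rfl⟩
  by_contra hp
  have hxj : x.1 j = 0 := by_contra fun h => hp (hx j h)
  have hyj : y.1 j = 0 := by_contra fun h => hp (hy j h)
  refine hj ?_
  change a * x.1 j + b * y.1 j = 0
  rw [hxj, hyj, mul_zero, mul_zero, add_zero]

lemma vertex_apply_ne_zero_iff {i j : Fin 5} :
    (stdSimplex.vertex i : stdSimplex ℝ (Fin 5)) j ≠ 0 ↔ j = i := by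
  simp [Pi.single_apply]

lemma monochromaticGraph_eq_iUnion (c : T.Vertex → Fin 3) (l : Fin 3) :
    T.monochromaticGraph c l =
      ⋃ s, T.proj s '' {x | ∀ j, x j ≠ 0 → c (T.vertex s j) = l} := by
  ext p
  simp only [monochromaticGraph, Set.mem_iUnion, Set.mem_image, Set.mem_ofPred_eq]
  exact exists_congr fun s => exists_congr fun x => by rw [and_comm, eq_comm]

/-- If each facet of each pentachoron has a vertex of colour `l`, then the monochromatic graph of
this colour is connected. -/
lemma isConnected_monochromaticGraph [ConnectedSpace T.Space] {c : T.Vertex → Fin 3} {l : Fin 3}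
    (h : ∀ s i, ∃ j, j ≠ i ∧ c (T.vertex s j) = l) : IsConnected (T.monochromaticGraph c l) := by
  have _ : Nonempty T.Pentachoron := by
    obtain ⟨⟨s, -⟩⟩ := (inferInstance : Nonempty T.Space)
    exact ⟨s⟩
  have hv {s : T.Pentachoron} {j : Fin 5} (hj : c (T.vertex s j) = l) :
      T.proj s (stdSimplex.vertex j) ∈
        T.proj s '' {x | ∀ j, x j ≠ 0 → c (T.vertex s j) = l} := by
    refine ⟨_, fun k hk => ?_, rfl⟩
    rw [vertex_apply_ne_zero_iff.1 hk, hj]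
  rw [monochromaticGraph_eq_iUnion]
  refine IsConnected.iUnion_of_reflTransGen (fun s => ⟨?_, ?_⟩) ?_
  · obtain ⟨j, -, hj⟩ := h s 0
    exact ⟨_, hv hj⟩
  · exact (isPreconnected_face _).image _ (continuous_proj T s).continuousOn
  · have _ : Std.Symm (fun s s' : T.Pentachoron =>
        (T.proj s '' {x | ∀ j, x j ≠ 0 → c (T.vertex s j) = l} ∩
          T.proj s' '' {x | ∀ j, x j ≠ 0 → c (T.vertex s' j) = l}).Nonempty) :=
      ⟨fun s s' hs => by rwa [Set.inter_comm]⟩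
    refine reflTransGen_of_adj fun s i => ?_
    -- This vertex lies on the common facet, hence in both monochromatic faces.
    obtain ⟨j, hji, hj⟩ := h s i
    refine ⟨T.proj s (stdSimplex.vertex j), hv hj, ?_⟩
    have hij : (stdSimplex.vertex j : stdSimplex ℝ (Fin 5)) i = 0 := by
      by_contra hne
      exact hji (vertex_apply_ne_zero_iff.1 hne).symm
    rw [proj_eq_of_apply_eq_zero T s hij, stdSimplex.map_vertex]
    refine hv (Eq.trans (congrArg c ?_) hj)
    exact (Quot.sound (VertexRel.glue s i j hji)).symm

/-- If no pentachoron has two vertices of colour `l`, then the monochromatic graph of this colour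
consists of vertices. -/
lemma monochromaticGraph_eq_monochromaticVertices {c : T.Vertex → Fin 3} {l : Fin 3}
    (h : ∀ s j j', c (T.vertex s j) = l → c (T.vertex s j') = l → j = j') :
    T.monochromaticGraph c l = T.monochromaticVertices c l := by
  ext p
  constructor
  · rintro ⟨s, x, rfl, hx⟩
    obtain ⟨j, hj⟩ : ∃ j, x j ≠ 0 := by
      by_contra! hcon
      have hsum := stdSimplex.sum_eq_one x
      simp [hcon] at hsum
    have hx0 (k : Fin 5) (hk : k ≠ j) : x k = 0 := by
      by_contra hne
      exact hk (h s k j (hx k hne) (hx j hj))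
    refine ⟨s, j, congrArg _ ?_, hx j hj⟩
    ext k
    rw [stdSimplex.vertex_coe, Pi.single_apply]
    split_ifs with hk
    · rw [hk, ← stdSimplex.sum_eq_one x, Finset.sum_eq_single j (fun k _ hk => hx0 k hk) (by simp)]
    · exact hx0 k hk
  · rintro ⟨s, j, rfl, hj⟩
    refine ⟨s, _, rfl, fun k hk => ?_⟩
    rw [vertex_apply_ne_zero_iff.1 hk, hj]

lemma finite_monochromaticVertices (c : T.Vertex → Fin 3) (l : Fin 3) :
    (T.monochromaticVertices c l).Finite := by
  refine (Set.finite_range fun p : T.Pentachoron × Fin 5 =>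
    T.proj p.1 (stdSimplex.vertex p.2)).subset ?_
  rintro _ ⟨s, j, rfl, -⟩
  exact ⟨(s, j), rfl⟩

/-! ### The tricoloring -/

/-- The colours of the labels: vertices of `T`, barycentres of tetrahedra and pentachora,
barycentres of triangles. -/
def flagColor : Fin 5 → Fin 3 := ![0, 0, 2, 1, 1]

lemma flagColor_swap01 (k : Fin 5) : flagColor (swap01 k) = flagColor k := by
  revert k
  decide

/-- The colours of the vertices of `flagSubdivision`. -/
def flagColoring (T : SingularTriangulation) : T.flagSubdivision.Vertex → Fin 3 :=
  Quot.lift (fun p => flagColor p.2) (by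
    rintro _ _ ⟨t, i, k, hk⟩
    obtain ⟨s, σ, rfl⟩ := exists_flagPiece_eq t
    by_cases hi : i = 4
    · subst hi
      rw [flagSubdivision_glue_four, parityCorrection]
      split_ifs
      · rfl
      · exact (flagColor_swap01 k).symm
    · rw [flagSubdivision_glue_of_ne s σ hi]
      exact (flagColor_swap01 k).symm)

lemma flagColoring_vertex (t : T.flagSubdivision.Pentachoron) (j : Fin 5) :
    T.flagColoring (T.flagSubdivision.vertex t j) = flagColor j := rfl

lemma isTricoloring_flagColoring (T : SingularTriangulation) :
    T.flagSubdivision.IsTricoloring T.flagColoring := by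
  refine fun t => ⟨2, fun l => ?_⟩
  simp only [flagColoring_vertex, Nat.card_eq_fintype_card]
  revert l
  decide

end SingularTriangulation

end

theorem mainTheorem5 {M : Type*} [TopologicalSpace M] [T2Space M] [CompactSpace M]
    [ConnectedSpace M] [ChartedSpace (EuclideanSpace ℝ (Fin 4)) M] [HasGroupoid M (plGroupoid 4)]
    (T : SingularTriangulation) (h : T.Space ≃ₜ M) (h_pl : T.IsPLHomeo h)
    (n : ℕ) (hn : Nat.card T.Pentachoron = n) :
    ∃ (T' : SingularTriangulation) (φ : SingularTriangulation.Subdivision T' T)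
      (c : T'.Vertex → Fin 3),
      Nat.card T'.Pentachoron = 60 * n ∧
      (∀ s : T.Pentachoron, Nat.card {s' : T'.Pentachoron // φ.carrier s' = s} = 60) ∧
      T'.IsPLHomeo (φ.homeo.trans h) ∧
      (T.IsOrientable → T'.IsOrientable) ∧
      (T.NoSelfPairing → T'.NoSelfPairing) ∧
      T'.IsTricoloring c ∧
      ∃ k : Fin 3,
        (∀ l, l ≠ k → IsConnected (T'.monochromaticGraph c l)) ∧
        (T'.monochromaticGraph c k).Nonempty ∧
        T'.monochromaticGraph c k = T'.monochromaticVertices c k ∧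
        IsDiscrete (T'.monochromaticGraph c k) := by
  have _ : T2Space T.Space := h.symm.t2Space
  let φ := T.subdivisionFlagSubdivision
  have _ : T2Space T.flagSubdivision.Space := φ.homeo.symm.t2Space
  have _ : ConnectedSpace T.flagSubdivision.Space :=
    (φ.homeo.trans h).symm.surjective.connectedSpace (φ.homeo.trans h).symm.continuous
  have hgraph : T.flagSubdivision.monochromaticGraph T.flagColoring 2 =
      T.flagSubdivision.monochromaticVertices T.flagColoring 2 := by
    refine SingularTriangulation.monochromaticGraph_eq_monochromaticVertices fun t => ?_
    simp only [SingularTriangulation.flagColoring_vertex]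
    decide
  refine ⟨T.flagSubdivision, φ, T.flagColoring, ?_, T.card_carrier_eq, φ.isPLHomeo h_pl,
    SingularTriangulation.IsOrientable.flagSubdivision,
    SingularTriangulation.NoSelfPairing.flagSubdivision, T.isTricoloring_flagColoring, 2,
    fun l hl => ?_, ?_, hgraph, ?_⟩
  · rw [T.card_flagSubdivision, hn]
  -- Colours 0 and 1 each occur on two labels, so dropping one label leaves another.
  · refine SingularTriangulation.isConnected_monochromaticGraph fun t => ?_
    simp only [SingularTriangulation.flagColoring_vertex]
    revert l
    decide
  · obtain ⟨⟨t, -⟩⟩ := (inferInstance : Nonempty T.flagSubdivision.Space)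
    rw [hgraph]
    exact ⟨_, t, 2, rfl, rfl⟩
  · rw [hgraph]
    exact (SingularTriangulation.finite_monochromaticVertices _ _).isDiscrete
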